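/- Let $\mathcal H$ be a separable infinite-dimensional real or complex Hilbert space, let $(\Omega,\mathcal F,\mathbb P)$ be a non-atomic Lebesgue probability space and let $\theta:\Omega\to\Omega$ be an invertible, bi-measurable, $\mathbb P$-preserving ergodic transformation. Let $\mathcal K_\infty(\Omega;\mathcal H)$ be the space of maps $T$ from $\Omega$ to the compact operators on $\mathcal H$ such that $\omega\mapsto T(\omega)x$ is measurable for every $x\in\mathcal H$ and $\|T\|_\infty:=\operatorname{ess\,sup}_{\omega}\|T(\omega)\|<\infty$. Put $T^0_\omega=\mathrm{id}$ and $T^n_\omega:=T(\theta^{n-1}\omega)\cdots T(\omega)$ for $n\ge1$, and let $\mathcal N$ be the set of all $T\in\mathcal K_\infty(\Omega;\mathcal H)$ such that, for $\mathbb P$-a.e. $\omega$, $$\Lambda_\omega(T):=\lim_{n\to\infty}\big((T^n_\omega)^*T^n_\omega\big)^{1/(2n)}=0\quad\text{in operator norm.}$$ A random unit vector on a measurable set $A\subset\Omega$ is a measurable map $e:A\to\mathcal H$ with $\|e(\omega)\|=1$ for all $\omega\in A$. **Proposition.** Let $T\in\mathcal N$ and $\varepsilon>0$. There is an integer $N^*=N^*(T,\varepsilon)$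 such that for every $N\ge N^*$ there is a set $V\in\mathcal F$ with $\mathbb P(V)>0$ such that $V,\theta V,\dots,\theta^NV$ are pairwise disjoint and the following two statements hold. (i) For every random unit vector $e$ on $V\cup\theta^NV$ there exist $S\in\mathcal K_\infty(\Omega;\mathcal H)$ and a measurable $\beta:\bigcup_{i=0}^{N-1}\theta^iV\to\mathbb R$ with $|\beta(\omega)|\ge\frac{\varepsilon}{3}$ for all $\omega\in\bigcup_{i=0}^{N-1}\theta^iV$ such that: - $S(\omega)=T(\omega)$ for $\omega\notin\bigcup_{i=0}^{N-1}\theta^iV$, and $\|S(\omega)-T(\omega)\|\le\varepsilon$ for $\omega\in\bigcup_{i=0}^{N-1}\theta^iV$; - $e$ extends to a random unit vector on $\bigcup_{i=0}^{N}\theta^iV$, again denoted by $e$, with $$S(\theta^i\omega)e(\theta^i\omega)=\beta(\theta^i\omega)\,e(\theta^{i+1}\omega)\qquad\text{for all }\omega\in V,\ i=0,1,\dots,N-1.$$ (ii) For every random unit vector $h$ on $V\cup\theta^NV$ there exist $R\in\mathcal K_\infty(\Omega;\mathcal H)$, an extension of $h$ to a random unit vector on $\Omega$, again denoted by $h$,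 and a measurable $\gamma:\Omega\to\mathbb R$ with $|\gamma(\omega)|\ge\frac{\varepsilon}{3}$ for all $\omega\in\Omega$, such that $\|R-T\|_\infty\le\varepsilon$ and $R(\omega)h(\omega)=\gamma(\omega)h(\theta\omega)$ for all $\omega\in\Omega$. -/

import Mathlib

open MeasureTheory Filter Topology

noncomputable section

/-- `f` is measurable modulo null sets and carries `μ` to `ν`. -/
def PreservesMeasureModZero {α β : Type*} [MeasurableSpace α] [MeasurableSpace β]
    (μ : Measure α) (ν : Measure β) (f : α → β) : Prop :=
  NullMeasurable f μ ∧ ∀ s : Set β, MeasurableSet s → μ (f ⁻¹' s) = ν s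

/-- `(Ω, P)` is a non-atomic Lebesgue probability space: it is isomorphic modulo null sets to the
unit interval with Lebesgue measure. The σ-algebra of `Ω` may or may not be complete. -/
def IsNonatomicLebesgueSpace {Ω : Type*} [MeasurableSpace Ω] (P : Measure Ω) : Prop :=
  ∃ (f : Ω → unitInterval) (g : unitInterval → Ω),
    PreservesMeasureModZero P volume f ∧ PreservesMeasureModZero volume P g ∧
      (∀ᵐ ω ∂P, g (f ω) = ω) ∧ (∀ᵐ t : unitInterval, f (g t) = t)

section RandomOperators

variable {𝕜 : Type*} [RCLike 𝕜] {Ω : Type*} [MeasurableSpace Ω]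
  {H : Type*} [NormedAddCommGroup H] [InnerProductSpace 𝕜 H]

/-- The essential supremum norm `‖T‖_∞` (with values in `[0, ∞]`). -/
def supNorm (P : Measure Ω) (T : Ω → H →L[𝕜] H) : ENNReal :=
  essSup (fun ω => ‖T ω‖ₑ) P

/-- The space `𝒦_∞(Ω; H)` of bounded random compact operators: maps from `Ω` to the compact
operators on `H` that are strongly measurable (`ω ↦ T(ω) x` is measurable for every `x`) and have
finite essential supremum norm. -/
def BoundedRandomCompact (𝕜 : Type*) [RCLike 𝕜] (H : Type*) [NormedAddCommGroup H]
    [InnerProductSpace 𝕜 H] [MeasurableSpace H] (P : Measure Ω) : Set (Ω → H →L[𝕜] H) :=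
  {T | (∀ ω, IsCompactOperator (T ω)) ∧ (∀ x : H, Measurable fun ω => T ω x) ∧
    supNorm P T < ⊤}

/-- The generated linear random dynamical system
`T^n_ω = T(θ^{n-1} ω) ∘ ⋯ ∘ T(θ ω) ∘ T(ω)`, with `T^0_ω = id`. -/
def cocycle (θ : Ω → Ω) (T : Ω → H →L[𝕜] H) : ℕ → Ω → H →L[𝕜] H
  | 0, _ => ContinuousLinearMap.id 𝕜 H
  | n + 1, ω => (T (θ^[n] ω)).comp (cocycle θ T n ω)

/-- `Λ` is the operator-norm limit of `((T^n_ω)* T^n_ω)^{1/(2n)}` as `n → ∞`; here `B n` is the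
(unique) positive `2n`-th root of the positive operator `(T^n_ω)* T^n_ω`. -/
def IsLyapunovLimit [CompleteSpace H] (θ : Ω → Ω) (T : Ω → H →L[𝕜] H) (ω : Ω)
    (Λ : H →L[𝕜] H) : Prop :=
  ∃ B : ℕ → H →L[𝕜] H,
    (∀ n : ℕ, 1 ≤ n → (B n).IsPositive ∧
      (B n) ^ (2 * n) =
        (ContinuousLinearMap.adjoint (cocycle θ T n ω)).comp (cocycle θ T n ω)) ∧
    Tendsto B atTop (𝓝 Λ)

/-- The set `𝒩` of bounded random compact operators converging to the null operator, i.e. with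
`Λ_ω(T) = 0` for almost every `ω`. -/
def NullSet (𝕜 : Type*) [RCLike 𝕜] (H : Type*) [NormedAddCommGroup H]
    [InnerProductSpace 𝕜 H] [CompleteSpace H] [MeasurableSpace H]
    (P : Measure Ω) (θ : Ω → Ω) : Set (Ω → H →L[𝕜] H) :=
  {T | T ∈ BoundedRandomCompact 𝕜 H P ∧ ∀ᵐ ω ∂P, IsLyapunovLimit θ T ω 0}

/-- `e` restricted to `A` is a random unit vector `A → H` (values of `e` off `A` are ignored). -/
def IsRandomUnitVectorOn {E : Type*} [NormedAddCommGroup E] [MeasurableSpace E]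
    (A : Set Ω) (e : Ω → E) : Prop :=
  Measurable (fun ω : A => e ω) ∧ ∀ ω ∈ A, ‖e ω‖ = 1

/-- `β` restricted to `A` is a real random variable `A → ℝ` with `|β| ≥ c` on `A`
(values of `β` off `A` are ignored). -/
def IsScalarVariableOn (A : Set Ω) (β : Ω → ℝ) (c : ℝ) : Prop :=
  Measurable (fun ω : A => β ω) ∧ ∀ ω ∈ A, c ≤ |β ω|

end RandomOperators

end

/-! Put `c = 2 * ε / 3`. Compact operators in infinite dimension have no positive lower bound on
unit vectors, so there is a random unit vector `f` with `‖T f‖ ≤ c` everywhere. Since the Lyapunov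
limit vanishes, `‖T^N_ω‖ ≤ c ^ N` with probability above 1/2 for large `N`, so this holds at both
`ω` and `θ^N ω` on a set of positive measure, inside which `V` is chosen.

Starting from `e` on `V ∪ θ^N V`, follow the normalized images under `T` as long as they are
stretched by more than `c`; at the first failure switch to `f` and stay there. If no failure
occurred in `N` steps, `T^N` would stretch `e` by more than `c ^ N` (`norm_apply_steer_le`). So at
step `N - 1` the image has norm at most `c`, leaving the next direction free, in particular free to
equal a prescribed one.

Where the image is small, a rank-one correction of norm at most `c + ε / 3 = ε` sends the direction
to `ε / 3` times the next one; elsewhere `T` already respects directions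
(`exists_perturbation_of_random_unit`). -/

open Function in
theorem image_iterate_eq_preimage_symm {Ω : Type*} [MeasurableSpace Ω] (θ : Ω ≃ᵐ Ω) (i : ℕ)
    (A : Set Ω) : θ^[i] '' A = θ.symm^[i] ⁻¹' A :=
  congrFun (Set.image_eq_preimage_of_inverse
    (LeftInverse.iterate (fun x => θ.symm_apply_apply x) i)
    (LeftInverse.iterate (fun x => θ.apply_symm_apply x) i)) A

theorem measurableSet_image_iterate {Ω : Type*} [MeasurableSpace Ω] (θ : Ω ≃ᵐ Ω) (i : ℕ)
    {A : Set Ω} (hA : MeasurableSet A) : MeasurableSet (θ^[i] '' A) := by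
  rw [image_iterate_eq_preimage_symm]
  exact (θ.symm.measurable.iterate i) hA

theorem symm_iterate_iterate {Ω : Type*} [MeasurableSpace Ω] (θ : Ω ≃ᵐ Ω) (i : ℕ) (ω : Ω) :
    θ.symm^[i] (θ^[i] ω) = ω :=
  Function.LeftInverse.iterate (fun x => θ.symm_apply_apply x) i ω

/-! ### Towers for ergodic maps -/

section Towers

variable {Ω : Type*}

theorem disjoint_image_iterate {θ : Ω → Ω} (hθ : Function.Injective θ) {B : Set Ω} {N : ℕ}
    (hB : ∀ k, 1 ≤ k → k ≤ N → ∀ ω ∈ B, θ^[k] ω ∉ B) {i j : ℕ} (hi : i ≤ N) (hj : j ≤ N)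
    (hij : i ≠ j) : Disjoint (θ^[i] '' B) (θ^[j] '' B) := by
  wlog hlt : i < j generalizing i j
  · exact (this hj hi hij.symm (by omega)).symm
  rw [Set.disjoint_left]
  rintro _ ⟨ω, hω, rfl⟩ ⟨ω', hω', h⟩
  obtain ⟨k, rfl⟩ := Nat.exists_eq_add_of_lt hlt
  rw [add_assoc, Function.iterate_add_apply] at h
  refine hB (k + 1) (by omega) (by omega) ω' hω' ?_
  rwa [(hθ.iterate i) h]

/-- A return between the two pieces is a return of `V` to itself at time `k`, `N - k` or `N + k`,
all below `2 * N`. -/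
theorem iterate_notMem_union_image {θ : Ω → Ω} (hθ : Function.Injective θ) {V : Set Ω} {N : ℕ}
    (hV : ∀ k, 1 ≤ k → k ≤ 2 * N → ∀ ω ∈ V, θ^[k] ω ∉ V) {k : ℕ} (h1 : 1 ≤ k) (hk : k < N) :
    ∀ ω ∈ V ∪ θ^[N] '' V, θ^[k] ω ∉ V ∪ θ^[N] '' V := by
  rintro ω (hω | ⟨ω, hω, rfl⟩) (h | ⟨ω', hω', h⟩)
  · exact hV k h1 (by omega) ω hω h
  · obtain ⟨m, rfl⟩ := Nat.exists_eq_add_of_lt hk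
    rw [add_assoc, Function.iterate_add_apply] at h
    refine hV (m + 1) (by omega) (by omega) ω' hω' ?_
    rwa [(hθ.iterate k) h]
  · rw [← Function.iterate_add_apply] at h
    exact hV (k + N) (by omega) (by omega) ω hω h
  · rw [← Function.iterate_add_apply, add_comm, Function.iterate_add_apply] at h
    refine hV k h1 (by omega) ω hω ?_
    rwa [← (hθ.iterate N) h]

variable [MeasurableSpace Ω] {P : Measure Ω}

/-- Pull back intervals of length `1 / (k + 1)`: countably many cover, so one meets `A` in positive
measure. -/
theorem IsNonatomicLebesgueSpace.exists_subset_measure_lt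
    (hP : IsNonatomicLebesgueSpace P) {A : Set Ω} (hA : 0 < P A) (hAm : MeasurableSet A)
    {k : ℕ} (hk : 1 ≤ k) :
    ∃ B ⊆ A, MeasurableSet B ∧ 0 < P B ∧ (k : ENNReal) * P B < 1 := by
  obtain ⟨f, -, ⟨hf, hfP⟩, -⟩ := hP
  set m : ℝ := k + 1 with hm
  have hm0 : 0 < m := by positivity
  let I : ℕ → Set unitInterval := fun j => {t | (j : ℝ) / m ≤ t ∧ (t : ℝ) < (j + 1) / m}
  have hIm : ∀ j, MeasurableSet (I j) := fun j =>
    (measurableSet_le measurable_const measurable_subtype_coe).inter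
      (measurableSet_lt measurable_subtype_coe measurable_const)
  have hIv : ∀ j, volume (I j) ≤ ENNReal.ofReal (1 / m) := by
    intro j
    rw [unitInterval.volume_apply]
    calc volume (Subtype.val '' I j) ≤ volume (Set.Ico ((j : ℝ) / m) ((j + 1) / m)) :=
          measure_mono (by rintro _ ⟨t, ht, rfl⟩; exact ht)
      _ = ENNReal.ofReal (1 / m) := by rw [Real.volume_Ico]; ring_nf
  have hcover : A ⊆ ⋃ j, A ∩ f ⁻¹' I j := by
    intro ω hω
    refine Set.mem_iUnion.2 ⟨⌊(f ω : ℝ) * m⌋₊, hω, ?_, ?_⟩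
    · rw [div_le_iff₀ hm0]
      exact Nat.floor_le (mul_nonneg (f ω).2.1 hm0.le)
    · rw [lt_div_iff₀ hm0]
      exact Nat.lt_floor_add_one _
  obtain ⟨j, hj⟩ : ∃ j, 0 < P (A ∩ f ⁻¹' I j) := by
    by_contra! h
    refine hA.ne' (measure_mono_null hcover (measure_iUnion_null fun j => ?_))
    exact le_antisymm (h j) zero_le
  have hnull : NullMeasurableSet (A ∩ f ⁻¹' I j) P :=
    hAm.nullMeasurableSet.inter (hf (hIm j))
  obtain ⟨B, hBA, hBm, hBe⟩ := hnull.exists_measurable_subset_ae_eq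
  refine ⟨B, hBA.trans Set.inter_subset_left, hBm, by rwa [measure_congr hBe], ?_⟩
  have h1 : P B ≤ ENNReal.ofReal (1 / m) :=
    (measure_mono (hBA.trans Set.inter_subset_right)).trans ((hfP _ (hIm j)).trans_le (hIv j))
  calc (k : ENNReal) * P B ≤ ENNReal.ofReal k * ENNReal.ofReal (1 / m) := by
        rw [ENNReal.ofReal_natCast]; gcongr
    _ = ENNReal.ofReal (k * (1 / m)) := (ENNReal.ofReal_mul (by positivity)).symm
    _ < 1 := by
        rw [ENNReal.ofReal_lt_one, mul_one_div, div_lt_one hm0]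
        linarith

/-- If almost all of a small set `B` returned at time `k`, the union of its first `k` preimages
would be almost invariant, hence null or full; but it contains `B` and has measure at most `k * P B
< 1`. -/
theorem Ergodic.exists_subset_iterate_notMem [IsProbabilityMeasure P]
    (hP : IsNonatomicLebesgueSpace P) {θ : Ω → Ω} (hθ : Ergodic θ P) {A : Set Ω}
    (hA : 0 < P A) (hAm : MeasurableSet A) {k : ℕ} (hk : 1 ≤ k) :
    ∃ V ⊆ A, MeasurableSet V ∧ 0 < P V ∧ ∀ ω ∈ V, θ^[k] ω ∉ V := by
  obtain ⟨B, hBA, hBm, hB0, hB1⟩ := hP.exists_subset_measure_lt hA hAm hk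
  have him : ∀ i, MeasurableSet (θ^[i] ⁻¹' B) := fun i => (hθ.measurable.iterate i) hBm
  refine ⟨B \ θ^[k] ⁻¹' B, Set.sdiff_subset.trans hBA, hBm.diff (him k), ?_,
    fun ω hω h => hω.2 h.1⟩
  by_contra hnull
  replace hnull : P (B \ θ^[k] ⁻¹' B) = 0 := by simpa using hnull
  set U : Set Ω := ⋃ i ∈ Finset.range k, θ^[i] ⁻¹' B with hU
  have hUm : MeasurableSet U := Finset.measurableSet_biUnion _ fun i _ => him i
  have hBU : B ⊆ U := fun ω hω =>
    Set.mem_biUnion (Finset.mem_coe.2 (Finset.mem_range.2 hk)) (by simpa using hω)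
  have hinv : U ≤ᵐ[P] θ ⁻¹' U := by
    have hae : ∀ᵐ ω ∂P, ω ∉ B \ θ^[k] ⁻¹' B := measure_eq_zero_iff_ae_notMem.1 hnull
    filter_upwards [hae] with ω hω hωU
    obtain ⟨i, hi, hiB⟩ := Set.mem_iUnion₂.1 hωU
    rw [Finset.mem_range] at hi
    -- A positive index shifts down by one; index `0` uses the return at time `k`.
    have key : ∃ j < k, θ^[j + 1] ω ∈ B := by
      rcases i with _ | i
      · refine ⟨k - 1, by omega, ?_⟩
        rw [Nat.sub_add_cancel hk]
        by_contra hn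
        exact hω ⟨hiB, hn⟩
      · exact ⟨i, by omega, hiB⟩
    obtain ⟨j, hj, hjB⟩ := key
    exact Set.mem_iUnion₂.2 ⟨j, Finset.mem_range.2 hj, by simpa using hjB⟩
  have hU1 : P U < 1 := by
    calc P U ≤ ∑ i ∈ Finset.range k, P (θ^[i] ⁻¹' B) := measure_biUnion_finset_le _ _
      _ = ∑ i ∈ Finset.range k, P B := Finset.sum_congr rfl fun i _ =>
          (hθ.toMeasurePreserving.iterate i).measure_preimage hBm.nullMeasurableSet
      _ = k * P B := by simp
      _ < 1 := hB1
  rcases hθ.ae_empty_or_univ_of_ae_le_preimage' hUm.nullMeasurableSet hinv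
    (measure_ne_top _ _) with h | h
  · have := measure_mono_null hBU ((measure_congr h).trans measure_empty)
    exact hB0.ne' this
  · rw [measure_congr h, measure_univ] at hU1
    exact lt_irrefl _ hU1

theorem Ergodic.exists_subset_forall_iterate_notMem [IsProbabilityMeasure P]
    (hP : IsNonatomicLebesgueSpace P) {θ : Ω → Ω} (hθ : Ergodic θ P) {A : Set Ω}
    (hA : 0 < P A) (hAm : MeasurableSet A) (M : ℕ) :
    ∃ V ⊆ A, MeasurableSet V ∧ 0 < P V ∧ ∀ k, 1 ≤ k → k ≤ M → ∀ ω ∈ V, θ^[k] ω ∉ V := by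
  induction M with
  | zero => exact ⟨A, subset_rfl, hAm, hA, fun k h1 h2 => by omega⟩
  | succ M ih =>
    obtain ⟨V, hVA, hVm, hV0, hV⟩ := ih
    obtain ⟨W, hWV, hWm, hW0, hW⟩ :=
      hθ.exists_subset_iterate_notMem hP hV0 hVm (Nat.le_add_left 1 M)
    refine ⟨W, hWV.trans hVA, hWm, hW0, fun k h1 h2 ω hω h => ?_⟩
    rcases Nat.lt_or_ge M k with hk | hk
    · obtain rfl : k = M + 1 := by omega
      exact hW ω hω h
    · exact hV k h1 hk ω (hWV hω) (hWV h)

end Towers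

/-! ### Random compact operators -/

section Operators

variable {𝕜 : Type*} [RCLike 𝕜] {Ω : Type*}
  {H : Type*} [NormedAddCommGroup H] [InnerProductSpace 𝕜 H]

/-- Otherwise `A` is bounded below, hence a closed embedding, and pulls a compact set back to a
compact neighbourhood of zero. -/
theorem IsCompactOperator.exists_norm_eq_one_norm_apply_lt (hH : ¬ FiniteDimensional 𝕜 H)
    [CompleteSpace H] {A : H →L[𝕜] H} (hA : IsCompactOperator A) {c : ℝ} (hc : 0 < c) :
    ∃ x : H, ‖x‖ = 1 ∧ ‖A x‖ < c := by
  by_contra! h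
  have hbound : ∀ x, ‖x‖ ≤ Real.toNNReal c⁻¹ * ‖A x‖ := by
    rw [Real.coe_toNNReal _ (by positivity)]
    intro x
    rcases eq_or_ne x 0 with rfl | hx
    · simp
    have hx0 : 0 < ‖x‖ := norm_pos_iff.2 hx
    have := h (((‖x‖⁻¹ : ℝ) : 𝕜) • x) (by simp [norm_smul, hx0.ne'])
    rw [map_smul, norm_smul, RCLike.norm_ofReal, abs_of_pos (inv_pos.2 hx0),
      le_inv_mul_iff₀ hx0] at this
    rw [le_inv_mul_iff₀ hc]
    linarith
  have hemb := (A.antilipschitz_of_bound hbound).isClosedEmbedding A.uniformContinuous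
  obtain ⟨K, hK, hK0⟩ := hA
  exact hH (FiniteDimensional.of_totallyBounded_nhds_zero 𝕜 hK0
    (hemb.isCompact_preimage hK).totallyBounded)

theorem IsLyapunovLimit.eventually_norm_cocycle_le [CompleteSpace H] {θ : Ω → Ω}
    {T : Ω → H →L[𝕜] H} {ω : Ω} (h : IsLyapunovLimit θ T ω 0) {c : ℝ} (hc : 0 < c) :
    ∀ᶠ n in atTop, ‖cocycle θ T n ω‖ ≤ c ^ n := by
  obtain ⟨B, hB, hlim⟩ := h
  have hlt : ∀ᶠ n in atTop, ‖B n‖ < c :=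
    (by simpa using hlim.norm : Tendsto (fun n => ‖B n‖) atTop (𝓝 0)).eventually_lt_const hc
  filter_upwards [hlt, eventually_ge_atTop 1] with n hn h1
  have hsq : ‖cocycle θ T n ω‖ * ‖cocycle θ T n ω‖ ≤ c ^ n * c ^ n := by
    rw [← ContinuousLinearMap.norm_adjoint_comp_self, ← (hB n h1).2, ← pow_add, ← two_mul]
    exact (norm_pow_le' _ (by omega)).trans (pow_le_pow_left₀ (norm_nonneg _) hn.le _)
  exact abs_le_of_sq_le_sq' (by nlinarith) (by positivity) |>.2

/-- The direction following `x` over `ω`: the default direction `f` if `T ω x` is at most `c` in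
norm, the direction of `T ω x` otherwise. -/
noncomputable def nextDirection (θ : Ω → Ω) (T : Ω → H →L[𝕜] H) (f : Ω → H) (c : ℝ) (ω : Ω) (x : H) : H :=
  open Classical in if ‖T ω x‖ ≤ c then f (θ ω) else ((‖T ω x‖⁻¹ : ℝ) : 𝕜) • T ω x

/-- The direction reached from `e ω` after `n` steps. -/
noncomputable def steer (θ : Ω → Ω) (T : Ω → H →L[𝕜] H) (f : Ω → H) (c : ℝ) (e : Ω → H) : ℕ → Ω → H
  | 0, ω => e ω
  | n + 1, ω => nextDirection θ T f c (θ^[n] ω) (steer θ T f c e n ω)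

/-! ### Steering a unit vector along an orbit -/

section Steer

variable {θ : Ω → Ω} {T : Ω → H →L[𝕜] H} {f e : Ω → H} {c : ℝ}

theorem norm_nextDirection (hf : ∀ ω, ‖f ω‖ = 1) (hc : 0 ≤ c) (ω : Ω) (x : H) :
    ‖nextDirection θ T f c ω x‖ = 1 := by
  unfold nextDirection
  split_ifs with h
  · exact hf _
  · have : 0 < ‖T ω x‖ := hc.trans_lt (not_le.1 h)
    simp [norm_smul, this.ne']

theorem norm_steer (hf : ∀ ω, ‖f ω‖ = 1) (he : ∀ ω, ‖e ω‖ = 1) (hc : 0 ≤ c) (n : ℕ) (ω : Ω) :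
    ‖steer θ T f c e n ω‖ = 1 := by
  cases n with
  | zero => exact he ω
  | succ n => exact norm_nextDirection hf hc _ _

/-- The first alternative persists, because the steered vector then equals `f`. Until it occurs each
step multiplies the stretching factor by more than `c`. -/
theorem norm_apply_steer_le_or (hTf : ∀ ω, ‖T ω (f ω)‖ ≤ c) (hc : 0 < c) (n : ℕ) (ω : Ω) :
    ‖T (θ^[n] ω) (steer θ T f c e n ω)‖ ≤ c ∨
      ∃ a : ℝ, c ^ n ≤ a ∧ cocycle θ T n ω (e ω) = (a : 𝕜) • steer θ T f c e n ω := by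
  induction n with
  | zero => exact Or.inr ⟨1, by simp, by simp [cocycle, steer]⟩
  | succ n ih =>
    by_cases h : ‖T (θ^[n] ω) (steer θ T f c e n ω)‖ ≤ c
    · left
      rw [steer, nextDirection, if_pos h, ← Function.iterate_succ_apply' θ]
      exact hTf _
    · obtain ⟨a, ha, hca⟩ := ih.resolve_left h
      right
      rw [not_le] at h
      refine ⟨a * ‖T (θ^[n] ω) (steer θ T f c e n ω)‖, ?_, ?_⟩
      · rw [pow_succ]
        exact mul_le_mul ha h.le hc.le ((pow_nonneg hc.le n).trans ha)
      · have h0 : (‖T (θ^[n] ω) (steer θ T f c e n ω)‖ : 𝕜) ≠ 0 := by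
          exact_mod_cast (hc.trans h).ne'
        rw [steer, nextDirection, if_neg h.not_ge, cocycle, ContinuousLinearMap.comp_apply, hca,
          map_smul, smul_smul]
        congr 1
        push_cast
        field_simp

theorem norm_apply_steer_le (hTf : ∀ ω, ‖T ω (f ω)‖ ≤ c) (hc : 0 < c)
    (he : ∀ ω, ‖e ω‖ = 1) {n : ℕ} {ω : Ω}
    (hω : ‖cocycle θ T (n + 1) ω‖ ≤ c ^ (n + 1)) :
    ‖T (θ^[n] ω) (steer θ T f c e n ω)‖ ≤ c := by
  rcases norm_apply_steer_le_or (θ := θ) (e := e) hTf hc n ω with h | ⟨a, ha, hca⟩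
  · exact h
  have ha0 : 0 < a := (pow_pos hc n).trans_le ha
  have h1 : ‖cocycle θ T (n + 1) ω (e ω)‖ ≤ c ^ (n + 1) := by
    simpa [he] using (cocycle θ T (n + 1) ω).le_of_opNorm_le hω (e ω)
  rw [cocycle, ContinuousLinearMap.comp_apply, hca, map_smul, norm_smul, RCLike.norm_ofReal,
    abs_of_pos ha0, pow_succ] at h1
  by_contra! hlt
  have : c ^ n * c < a * ‖T (θ^[n] ω) (steer θ T f c e n ω)‖ :=
    mul_lt_mul' ha hlt hc.le ha0
  linarith

end Steer

/-- The rank-one modification of `A` sending the unit vector `x` to `y`. -/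
noncomputable def redirect (A : H →L[𝕜] H) (x y : H) : H →L[𝕜] H :=
  A + (innerSL 𝕜 x).smulRight (y - A x)

theorem redirect_apply (A : H →L[𝕜] H) (x y z : H) :
    redirect A x y z = A z + inner 𝕜 x z • (y - A x) := by
  simp [redirect]

theorem redirect_apply_self (A : H →L[𝕜] H) {x : H} (hx : ‖x‖ = 1) (y : H) :
    redirect A x y x = y := by
  simp [redirect_apply, inner_self_eq_norm_sq_to_K, hx]

theorem norm_redirect_sub (A : H →L[𝕜] H) {x : H} (hx : ‖x‖ = 1) (y : H) :
    ‖redirect A x y - A‖ = ‖y - A x‖ := by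
  rw [redirect, add_sub_cancel_left, ContinuousLinearMap.norm_smulRight_apply, innerSL_apply_norm,
    hx, one_mul]

theorem isCompactOperator_redirect {A : H →L[𝕜] H} (hA : IsCompactOperator A) (x y : H) :
    IsCompactOperator (redirect A x y) :=
  have hx : IsCompactOperator (innerSL 𝕜 x) :=
    isCompactOperator_of_locallyCompactSpace_dom (innerSL 𝕜 x)
  hA.add (hx.continuous_comp (g := fun a : 𝕜 => a • (y - A x))
    (continuous_id.smul continuous_const))

/-! ### Measurability, selection and perturbation -/

variable [MeasurableSpace Ω]

theorem IsRandomUnitVectorOn.exists_measurable_eqOn {E : Type*} [NormedAddCommGroup E]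
    [MeasurableSpace E] {A : Set Ω} (hA : MeasurableSet A) {e f : Ω → E}
    (he : IsRandomUnitVectorOn A e) (hf : Measurable f) (hf1 : ∀ ω, ‖f ω‖ = 1) :
    ∃ e' : Ω → E, Measurable e' ∧ (∀ ω, ‖e' ω‖ = 1) ∧ Set.EqOn e' e A := by
  classical
  refine ⟨A.piecewise e f, ?_, fun ω => ?_, fun ω hω => Set.piecewise_eq_of_mem _ _ _ hω⟩
  · refine measurable_of_restrict_of_restrict_compl hA ?_ ?_
    · rw [Set.domRestrict_piecewise]; exact he.1
    · rw [Set.domRestrict_piecewise_compl]; exact hf.comp measurable_subtype_coe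
  · by_cases hω : ω ∈ A
    · rw [Set.piecewise_eq_of_mem _ _ _ hω, he.2 ω hω]
    · rw [Set.piecewise_eq_of_notMem _ _ _ hω, hf1]

theorem mem_boundedRandomCompact_of_norm_sub_le [MeasurableSpace H] {P : Measure Ω}
    {T S : Ω → H →L[𝕜] H}
    (hT : T ∈ BoundedRandomCompact 𝕜 H P) (hSc : ∀ ω, IsCompactOperator (S ω))
    (hSm : ∀ x, Measurable fun ω => S ω x) {r : ℝ} (hS : ∀ ω, ‖S ω - T ω‖ ≤ r) :
    S ∈ BoundedRandomCompact 𝕜 H P := by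
  refine ⟨hSc, hSm, ?_⟩
  have hle : supNorm P S ≤ supNorm P T + ENNReal.ofReal r := by
    refine essSup_le_of_ae_le _ ?_
    filter_upwards [ENNReal.ae_le_essSup fun ω => ‖T ω‖ₑ] with ω hω
    calc ‖S ω‖ₑ = ‖T ω + (S ω - T ω)‖ₑ := by rw [add_sub_cancel]
      _ ≤ ‖T ω‖ₑ + ‖S ω - T ω‖ₑ := by
          simpa only [← ofReal_norm, ← ENNReal.ofReal_add (norm_nonneg _) (norm_nonneg _)] using
            ENNReal.ofReal_le_ofReal (norm_add_le (T ω) (S ω - T ω))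
      _ ≤ supNorm P T + ENNReal.ofReal r := by
          gcongr
          · exact hω
          · rw [← ofReal_norm]; exact ENNReal.ofReal_le_ofReal (hS ω)
  exact hle.trans_lt (ENNReal.add_lt_top.2 ⟨hT.2.2, ENNReal.ofReal_lt_top⟩)

variable [MeasurableSpace H] [BorelSpace H] [TopologicalSpace.SeparableSpace H]

theorem measurable_clm_apply_of_forall {T : Ω → H →L[𝕜] H} (hT : ∀ x, Measurable fun ω => T ω x)
    {g : Ω → H} (hg : Measurable g) : Measurable fun ω => T ω (g ω) := by
  have : SecondCountableTopology H := UniformSpace.secondCountable_of_separable H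
  have := measurable_uncurry_of_continuous_of_measurable (u := fun x ω => T ω x)
    (fun ω => (T ω).continuous) hT
  exact this.comp (hg.prodMk measurable_id)

theorem measurable_cocycle_apply {θ : Ω → Ω} (hθ : Measurable θ) {T : Ω → H →L[𝕜] H}
    (hT : ∀ x, Measurable fun ω => T ω x) (n : ℕ) (x : H) :
    Measurable fun ω => cocycle θ T n ω x := by
  induction n with
  | zero => exact measurable_const
  | succ n ih =>
    exact measurable_clm_apply_of_forall (T := fun ω => T (θ^[n] ω))
      (fun y => (hT y).comp (hθ.iterate n)) ih

theorem measurableSet_norm_clm_le {A : Ω → H →L[𝕜] H} (hA : ∀ x, Measurable fun ω => A ω x)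
    {c : ℝ} (hc : 0 ≤ c) : MeasurableSet {ω | ‖A ω‖ ≤ c} := by
  have : {ω | ‖A ω‖ ≤ c} =
      ⋂ n, {ω | ‖A ω (TopologicalSpace.denseSeq H n)‖ ≤ c * ‖TopologicalSpace.denseSeq H n‖} := by
    ext ω
    simp only [Set.mem_ofPred_eq, Set.mem_iInter]
    refine ⟨fun h n => (A ω).le_of_opNorm_le h _, fun h => (A ω).opNorm_le_bound hc fun x => ?_⟩
    exact (TopologicalSpace.denseRange_denseSeq H).induction_on x
      (isClosed_le (A ω).continuous.norm (continuous_const.mul continuous_norm)) h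
  rw [this]
  exact MeasurableSet.iInter fun n => measurableSet_le (hA _).norm measurable_const

/-- Take the first suitable vector of a dense sequence in the unit sphere; the strict inequality is
open, so one exists. -/
theorem exists_measurable_unit_norm_apply_le [CompleteSpace H] (hH : ¬ FiniteDimensional 𝕜 H)
    {T : Ω → H →L[𝕜] H} (hTc : ∀ ω, IsCompactOperator (T ω))
    (hT : ∀ x, Measurable fun ω => T ω x) {c : ℝ} (hc : 0 < c) :
    ∃ f : Ω → H, Measurable f ∧ (∀ ω, ‖f ω‖ = 1) ∧ ∀ ω, ‖T ω (f ω)‖ ≤ c := by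
  classical
  have : SecondCountableTopology H := UniformSpace.secondCountable_of_separable H
  obtain ⟨x₀, hx₀, -⟩ :=
    (isCompactOperator_zero (M₁ := H) (M₂ := H)).exists_norm_eq_one_norm_apply_lt
      (A := (0 : H →L[𝕜] H)) hH one_pos
  have : Nonempty {x : H | ‖x‖ = 1} := ⟨⟨x₀, hx₀⟩⟩
  let u := TopologicalSpace.denseSeq {x : H | ‖x‖ = 1}
  have hex : ∀ ω, ∃ n, ‖T ω (u n)‖ < c := by
    intro ω
    obtain ⟨x, hx, hxc⟩ := (hTc ω).exists_norm_eq_one_norm_apply_lt hH hc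
    have hopen : IsOpen {y : {x : H | ‖x‖ = 1} | ‖T ω y‖ < c} :=
      isOpen_lt ((T ω).continuous.comp continuous_subtype_val).norm continuous_const
    exact (TopologicalSpace.denseRange_denseSeq _).exists_mem_open hopen ⟨⟨x, hx⟩, hxc⟩
  refine ⟨fun ω => u (Nat.find (hex ω)), ?_, fun ω => (u _).2, fun ω => (Nat.find_spec (hex ω)).le⟩
  have hfind := measurable_find hex fun k =>
    measurableSet_lt (hT (u k)).norm measurable_const
  exact (measurable_of_countable fun n => (u n : H)).comp hfind

theorem exists_forall_measure_norm_cocycle_le [CompleteSpace H] {P : Measure Ω}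
    [IsProbabilityMeasure P] {θ : Ω → Ω} (hθ : MeasurePreserving θ P P) {T : Ω → H →L[𝕜] H}
    (hT : T ∈ NullSet 𝕜 H P θ) {c : ℝ} (hc : 0 < c) :
    ∃ N₀ : ℕ, ∀ N, N₀ ≤ N → 0 < P ({ω | ‖cocycle θ T N ω‖ ≤ c ^ N} ∩
      θ^[N] ⁻¹' {ω | ‖cocycle θ T N ω‖ ≤ c ^ N}) := by
  have hGm : ∀ n, MeasurableSet {ω | ‖cocycle θ T n ω‖ ≤ c ^ n} := fun n =>
    measurableSet_norm_clm_le (measurable_cocycle_apply hθ.measurable hT.1.2.1 n) (by positivity)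
  have hlim : Tendsto (fun n => P {ω | ‖cocycle θ T n ω‖ ≤ c ^ n}ᶜ) atTop (𝓝 (P ∅)) := by
    refine tendsto_measure_of_ae_tendsto_indicator_of_isFiniteMeasure atTop MeasurableSet.empty
      (fun n => (hGm n).compl) ?_
    filter_upwards [hT.2] with ω hω
    filter_upwards [hω.eventually_norm_cocycle_le hc] with n hn
    simpa using hn
  rw [measure_empty] at hlim
  -- Exceptional sets of measure below 1/2 at both `ω` and `θ^N ω` cannot cover the space.
  have hlt := hlim.eventually_lt_const (show (0 : ENNReal) < 2⁻¹ by simp)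
  obtain ⟨N₀, hN₀⟩ := eventually_atTop.1 hlt
  refine ⟨N₀, fun N hN => ?_⟩
  have hsmall := hN₀ N hN
  set G := {ω | ‖cocycle θ T N ω‖ ≤ c ^ N} with hG
  by_contra h
  replace h : P (G ∩ θ^[N] ⁻¹' G) = 0 := by simpa using h
  have hcompl : P (G ∩ θ^[N] ⁻¹' G)ᶜ < 1 := by
    rw [Set.compl_inter]
    calc P (Gᶜ ∪ (θ^[N] ⁻¹' G)ᶜ) ≤ P Gᶜ + P (θ^[N] ⁻¹' Gᶜ) := measure_union_le _ _
      _ = P Gᶜ + P Gᶜ := by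
          rw [(hθ.iterate N).measure_preimage (hGm N).compl.nullMeasurableSet]
      _ < 2⁻¹ + 2⁻¹ := ENNReal.add_lt_add hsmall hsmall
      _ = 1 := ENNReal.inv_two_add_inv_two
  rw [prob_compl_eq_one_sub ((hGm N).inter ((hθ.iterate N).measurable (hGm N))), h] at hcompl
  simp at hcompl

theorem measurable_steer {θ : Ω → Ω} {T : Ω → H →L[𝕜] H} {f e : Ω → H} {c : ℝ}
    (hθ : Measurable θ) (hT : ∀ x, Measurable fun ω => T ω x)
    (hf : Measurable f) (he : Measurable e) (n : ℕ) : Measurable (steer θ T f c e n) := by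
  have : SecondCountableTopology H := UniformSpace.secondCountable_of_separable H
  induction n with
  | zero => exact he
  | succ n ih =>
    have h : Measurable fun ω => T (θ^[n] ω) (steer θ T f c e n ω) :=
      measurable_clm_apply_of_forall (T := fun ω => T (θ^[n] ω))
        (fun y => (hT y).comp (hθ.iterate n)) ih
    exact Measurable.ite (measurableSet_le h.norm measurable_const)
      (hf.comp (hθ.comp (hθ.iterate n)))
      ((RCLike.measurable_ofReal.comp h.norm.inv).smul h)

/-- A random unit vector on a tower base extends to a random unit vector along which `T` is either
small or respects directions. -/
theorem exists_random_unit_extension {θ : Ω ≃ᵐ Ω} {T : Ω → H →L[𝕜] H}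
    (hT : ∀ x, Measurable fun ω => T ω x) {f e : Ω → H} {c : ℝ} (hc : 0 < c)
    (hf : Measurable f) (hf1 : ∀ ω, ‖f ω‖ = 1) (hTf : ∀ ω, ‖T ω (f ω)‖ ≤ c)
    (he : Measurable e) (he1 : ∀ ω, ‖e ω‖ = 1) {B : Set Ω} (hBm : MeasurableSet B) {n : ℕ}
    (hB : ∀ k, 1 ≤ k → k ≤ n → ∀ ω ∈ B, θ^[k] ω ∉ B)
    (hBT : ∀ ω ∈ B, ‖cocycle θ T (n + 1) ω‖ ≤ c ^ (n + 1)) :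
    ∃ h : Ω → H, Measurable h ∧ (∀ ω, ‖h ω‖ = 1) ∧ Set.EqOn h e B ∧
      ∀ ω, ‖T ω (h ω)‖ ≤ c ∨ T ω (h ω) = (‖T ω (h ω)‖ : 𝕜) • h (θ ω) := by
  classical
  let g := steer θ T f c e
  -- The field is built level by level over `B`, with `f` as the value off the levels already
  -- treated.
  have hinduct : ∀ m, m ≤ n + 1 → ∃ h : Ω → H, Measurable h ∧ (∀ ω, ‖h ω‖ = 1) ∧
      (∀ i < m, ∀ ω ∈ B, h (θ^[i] ω) = g i ω) ∧
      ∀ ω, (∀ i < m, ω ∉ θ^[i] '' B) → h ω = f ω := by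
    intro m
    induction m with
    | zero => exact fun _ => ⟨f, hf, hf1, by simp, by simp⟩
    | succ m ih =>
      intro hm
      obtain ⟨h, hh, hh1, hhB, hhf⟩ := ih (by omega)
      refine ⟨(θ^[m] '' B).piecewise (fun ω => g m (θ.symm^[m] ω)) h, ?_, ?_, ?_, ?_⟩
      · exact Measurable.piecewise (measurableSet_image_iterate θ m hBm)
          ((measurable_steer θ.measurable hT hf he m).comp (θ.symm.measurable.iterate m)) hh
      · intro ω
        by_cases hω : ω ∈ θ^[m] '' B
        · rw [Set.piecewise_eq_of_mem _ _ _ hω]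
          exact norm_steer hf1 he1 hc.le _ _
        · rw [Set.piecewise_eq_of_notMem _ _ _ hω, hh1]
      · intro i hi ω hω
        rcases Nat.lt_succ_iff_lt_or_eq.1 hi with hi' | rfl
        · have hnot : θ^[i] ω ∉ θ^[m] '' B := Set.disjoint_left.1
            (disjoint_image_iterate θ.injective hB (by omega) (by omega) hi'.ne) ⟨ω, hω, rfl⟩
          rw [Set.piecewise_eq_of_notMem _ _ _ hnot, hhB i hi' ω hω]
        · rw [Set.piecewise_eq_of_mem _ _ _ (Set.mem_image_of_mem _ hω), symm_iterate_iterate]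
      · intro ω hω
        rw [Set.piecewise_eq_of_notMem _ _ _ (hω m (by omega))]
        exact hhf ω fun i hi => hω i (by omega)
  obtain ⟨h, hh, hh1, hhB, hhf⟩ := hinduct (n + 1) le_rfl
  refine ⟨h, hh, hh1, fun ω hω => hhB 0 (by omega) ω hω, fun ω => ?_⟩
  by_cases hω : ∃ i < n + 1, ω ∈ θ^[i] '' B
  · obtain ⟨i, hi, ω, hωB, rfl⟩ := hω
    by_cases hsmall : ‖T (θ^[i] ω) (g i ω)‖ ≤ c
    · rw [hhB i hi ω hωB]
      exact Or.inl hsmall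
    · right
      -- At the top level the image is small, so no relation to the next direction is needed there.
      have hin : i ≠ n := by
        rintro rfl
        exact hsmall (norm_apply_steer_le hTf hc he1 (hBT ω hωB))
      rw [← Function.iterate_succ_apply' θ, hhB i hi ω hωB, hhB (i + 1) (by omega) ω hωB]
      change _ = _ • nextDirection θ T f c (θ^[i] ω) (g i ω)
      have h0 : (‖T (θ^[i] ω) (g i ω)‖ : 𝕜) ≠ 0 := by
        exact_mod_cast (hc.trans (not_le.1 hsmall)).ne'
      rw [nextDirection, if_neg hsmall, smul_smul, RCLike.ofReal_inv, mul_inv_cancel₀ h0, one_smul]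
  · rw [hhf ω fun i hi hmem => hω ⟨i, hi, hmem⟩]
    exact Or.inl (hTf ω)

theorem exists_perturbation_of_random_unit {P : Measure Ω} {θ : Ω → Ω} (hθ : Measurable θ)
    {T : Ω → H →L[𝕜] H} (hT : T ∈ BoundedRandomCompact 𝕜 H P) {ε : ℝ} (hε : 0 < ε) {h : Ω → H}
    (hh : Measurable h) (hh1 : ∀ ω, ‖h ω‖ = 1)
    (hhT : ∀ ω, ‖T ω (h ω)‖ ≤ 2 * ε / 3 ∨ T ω (h ω) = (‖T ω (h ω)‖ : 𝕜) • h (θ ω)) :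
    ∃ R ∈ BoundedRandomCompact 𝕜 H P, ∃ γ : Ω → ℝ, Measurable γ ∧ (∀ ω, ε / 3 ≤ |γ ω|) ∧
      (∀ ω, ‖R ω - T ω‖ ≤ ε) ∧ ∀ ω, R ω (h ω) = (γ ω : 𝕜) • h (θ ω) := by
  classical
  have : SecondCountableTopology H := UniformSpace.secondCountable_of_separable H
  have hTh : Measurable fun ω => T ω (h ω) := measurable_clm_apply_of_forall hT.2.1 hh
  let γ : Ω → ℝ := fun ω => if ‖T ω (h ω)‖ ≤ 2 * ε / 3 then ε / 3 else ‖T ω (h ω)‖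
  have hγm : Measurable γ :=
    Measurable.ite (measurableSet_le hTh.norm measurable_const) measurable_const hTh.norm
  have hsmul : Measurable fun ω => (γ ω : 𝕜) • h (θ ω) :=
    (RCLike.measurable_ofReal.comp hγm).smul (hh.comp hθ)
  let R : Ω → H →L[𝕜] H := fun ω => redirect (T ω) (h ω) ((γ ω : 𝕜) • h (θ ω))
  have hR : ∀ ω, ‖R ω - T ω‖ ≤ ε := by
    intro ω
    rw [norm_redirect_sub _ (hh1 ω)]
    by_cases hω : ‖T ω (h ω)‖ ≤ 2 * ε / 3
    · calc ‖(γ ω : 𝕜) • h (θ ω) - T ω (h ω)‖ ≤ ‖(γ ω : 𝕜) • h (θ ω)‖ + ‖T ω (h ω)‖ :=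
            norm_sub_le _ _
        _ ≤ ε / 3 + 2 * ε / 3 := by
            gcongr
            rw [norm_smul, hh1, mul_one, RCLike.norm_ofReal, show γ ω = ε / 3 from if_pos hω,
              abs_of_pos (by positivity)]
        _ = ε := by ring
    · rw [show γ ω = ‖T ω (h ω)‖ from if_neg hω, ← (hhT ω).resolve_left hω, sub_self, norm_zero]
      exact hε.le
  refine ⟨R, mem_boundedRandomCompact_of_norm_sub_le hT
    (fun ω => isCompactOperator_redirect (hT.1 ω) _ _) (fun x => ?_) hR, γ, hγm, fun ω => ?_, hR,
    fun ω => redirect_apply_self _ (hh1 ω) _⟩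
  · simp only [R, redirect_apply]
    exact (hT.2.1 x).add ((hh.inner measurable_const).smul (hsmul.sub hTh))
  · by_cases hω : ‖T ω (h ω)‖ ≤ 2 * ε / 3
    · rw [show γ ω = ε / 3 from if_pos hω]
      exact le_abs_self _
    · rw [show γ ω = ‖T ω (h ω)‖ from if_neg hω, abs_norm]
      rw [not_le] at hω
      linarith

end Operators

theorem mainTheorem7
    {𝕜 : Type*} [RCLike 𝕜]
    {H : Type*} [NormedAddCommGroup H] [InnerProductSpace 𝕜 H] [CompleteSpace H]
    [TopologicalSpace.SeparableSpace H] [MeasurableSpace H] [BorelSpace H]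
    (hH : ¬ FiniteDimensional 𝕜 H)
    {Ω : Type*} [MeasurableSpace Ω] (P : Measure Ω) [IsProbabilityMeasure P]
    (hP : IsNonatomicLebesgueSpace P)
    (θ : Ω ≃ᵐ Ω) (hθ : Ergodic θ P)
    (T : Ω → H →L[𝕜] H) (hT : T ∈ NullSet 𝕜 H P θ)
    (ε : ℝ) (hε : 0 < ε) :
    ∃ Nstar : ℕ, ∀ N : ℕ, Nstar ≤ N → ∃ V : Set Ω, MeasurableSet V ∧ 0 < P V ∧
      (∀ i j : ℕ, i ≤ N → j ≤ N → i ≠ j → Disjoint (θ^[i] '' V) (θ^[j] '' V)) ∧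
      -- (i) prescribed directions on `V` and `θ^N V` are joined along the tower
      (∀ e : Ω → H, IsRandomUnitVectorOn (V ∪ θ^[N] '' V) e →
        ∃ S ∈ BoundedRandomCompact 𝕜 H P, ∃ β : Ω → ℝ,
          IsScalarVariableOn (⋃ i ∈ Finset.range N, θ^[i] '' V) β (ε / 3) ∧
          (∀ ω, ω ∉ (⋃ i ∈ Finset.range N, θ^[i] '' V) → S ω = T ω) ∧
          (∀ ω ∈ (⋃ i ∈ Finset.range N, θ^[i] '' V), ‖S ω - T ω‖ ≤ ε) ∧
          ∃ e' : Ω → H,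
            IsRandomUnitVectorOn (⋃ i ∈ Finset.range (N + 1), θ^[i] '' V) e' ∧
            Set.EqOn e' e (V ∪ θ^[N] '' V) ∧
            ∀ ω ∈ V, ∀ i < N,
              S (θ^[i] ω) (e' (θ^[i] ω)) = (β (θ^[i] ω) : 𝕜) • e' (θ^[i + 1] ω)) ∧
      -- (ii) a global perturbation with an invariant random unit vector
      (∀ h : Ω → H, IsRandomUnitVectorOn (V ∪ θ^[N] '' V) h →
        ∃ R ∈ BoundedRandomCompact 𝕜 H P, ∃ h' : Ω → H, ∃ γ : Ω → ℝ,
          IsRandomUnitVectorOn Set.univ h' ∧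
          Set.EqOn h' h (V ∪ θ^[N] '' V) ∧
          IsScalarVariableOn Set.univ γ (ε / 3) ∧
          supNorm P (fun ω => R ω - T ω) ≤ ENNReal.ofReal ε ∧
          ∀ ω, R ω (h' ω) = (γ ω : 𝕜) • h' (θ ω)) := by
  classical
  have hc : 0 < 2 * ε / 3 := by positivity
  obtain ⟨N₀, hN₀⟩ := exists_forall_measure_norm_cocycle_le hθ.toMeasurePreserving hT hc
  obtain ⟨f, hf, hf1, hTf⟩ := exists_measurable_unit_norm_apply_le hH hT.1.1 hT.1.2.1 hc
  refine ⟨N₀ + 1, fun N hN => ?_⟩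
  obtain ⟨n, rfl⟩ : ∃ n, N = n + 1 := ⟨N - 1, by omega⟩
  have hGm : MeasurableSet {ω | ‖cocycle θ T (n + 1) ω‖ ≤ (2 * ε / 3) ^ (n + 1)} :=
    measurableSet_norm_clm_le (measurable_cocycle_apply θ.measurable hT.1.2.1 (n + 1))
      (by positivity)
  -- Twice the height, so that the `n + 1` levels over `V ∪ θ^[n + 1] '' V`, base included, are
  -- disjoint as well.
  obtain ⟨V, hVG, hVm, hV0, hV⟩ := hθ.exists_subset_forall_iterate_notMem hP
    (hN₀ (n + 1) (by omega)) (hGm.inter ((θ.measurable.iterate (n + 1)) hGm)) (2 * (n + 1))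
  set B : Set Ω := V ∪ θ^[n + 1] '' V with hB
  have hBm : MeasurableSet B := hVm.union (measurableSet_image_iterate θ _ hVm)
  have hBT : ∀ ω ∈ B, ‖cocycle θ T (n + 1) ω‖ ≤ (2 * ε / 3) ^ (n + 1) := by
    rintro ω (hω | ⟨ω, hω, rfl⟩)
    exacts [(hVG hω).1, (hVG hω).2]
  -- This global perturbation is (ii); cutting it back to `T` off the tower gives (i).
  have main : ∀ e : Ω → H, IsRandomUnitVectorOn B e →
      ∃ R ∈ BoundedRandomCompact 𝕜 H P, ∃ h : Ω → H, ∃ γ : Ω → ℝ,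
        Measurable h ∧ (∀ ω, ‖h ω‖ = 1) ∧ Set.EqOn h e B ∧ Measurable γ ∧
        (∀ ω, ε / 3 ≤ |γ ω|) ∧ (∀ ω, ‖R ω - T ω‖ ≤ ε) ∧
        ∀ ω, R ω (h ω) = (γ ω : 𝕜) • h (θ ω) := by
    intro e he
    obtain ⟨e', he', he1, hee⟩ := he.exists_measurable_eqOn hBm hf hf1
    obtain ⟨h, hh, hh1, hhe, hhT⟩ := exists_random_unit_extension hT.1.2.1 hc hf hf1 hTf he' he1
      hBm (fun k h1 hk => iterate_notMem_union_image θ.injective hV h1 (by omega)) hBT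
    obtain ⟨R, hR, γ, hγ, hγ1, hRT, hRh⟩ :=
      exists_perturbation_of_random_unit θ.measurable hT.1 hε hh hh1 hhT
    exact ⟨R, hR, h, γ, hh, hh1, hhe.trans hee, hγ, hγ1, hRT, hRh⟩
  refine ⟨V, hVm, hV0, fun i j hi hj hij => disjoint_image_iterate θ.injective hV (by omega)
    (by omega) hij, fun e he => ?_, fun e he => ?_⟩
  · obtain ⟨R, hR, h, γ, hh, hh1, hhe, hγ, hγ1, hRT, hRh⟩ := main e he
    set W : Set Ω := ⋃ i ∈ Finset.range (n + 1), θ^[i] '' V with hW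
    have hWm : MeasurableSet W :=
      Finset.measurableSet_biUnion _ fun i _ => measurableSet_image_iterate θ i hVm
    have hin : ∀ ω ∈ W, W.piecewise R T ω = R ω := fun ω hω => Set.piecewise_eq_of_mem _ _ _ hω
    have hout : ∀ ω ∉ W, W.piecewise R T ω = T ω :=
      fun ω hω => Set.piecewise_eq_of_notMem _ _ _ hω
    refine ⟨W.piecewise R T, ?_, γ, ⟨hγ.comp measurable_subtype_coe, fun ω _ => hγ1 ω⟩, hout,
      fun ω hω => (hin ω hω).symm ▸ hRT ω, h,
      ⟨hh.comp measurable_subtype_coe, fun ω _ => hh1 ω⟩, hhe, fun ω hω i hi => ?_⟩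
    · refine mem_boundedRandomCompact_of_norm_sub_le (r := ε) hT.1 (fun ω => ?_) (fun x => ?_)
        fun ω => ?_
      · by_cases hω : ω ∈ W
        · rw [hin ω hω]; exact hR.1 ω
        · rw [hout ω hω]; exact hT.1.1 ω
      · have : (fun ω => W.piecewise R T ω x) = W.piecewise (fun ω => R ω x) fun ω => T ω x := by
          ext ω
          by_cases hω : ω ∈ W <;> simp [hω]
        rw [this]
        exact Measurable.piecewise hWm (hR.2.1 x) (hT.1.2.1 x)
      · by_cases hω : ω ∈ W
        · rw [hin ω hω]; exact hRT ω
        · rw [hout ω hω, sub_self, norm_zero]; exact hε.le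
    · rw [hin _ (Set.mem_biUnion (Finset.mem_coe.2 (Finset.mem_range.2 hi)) ⟨ω, hω, rfl⟩), hRh,
        Function.iterate_succ_apply']
  · obtain ⟨R, hR, h, γ, hh, hh1, hhe, hγ, hγ1, hRT, hRh⟩ := main e he
    refine ⟨R, hR, h, γ, ⟨hh.comp measurable_subtype_coe, fun ω _ => hh1 ω⟩, hhe,
      ⟨hγ.comp measurable_subtype_coe, fun ω _ => hγ1 ω⟩, ?_, hRh⟩
    refine essSup_le_of_ae_le _ (Eventually.of_forall fun ω => ?_)
    change ‖R ω - T ω‖ₑ ≤ ENNReal.ofReal ε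
    rw [← ofReal_norm]
    exact ENNReal.ofReal_le_ofReal (hRT ω)
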